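/- For a finite set $\Lambda$ with $N:=|\Lambda|\ge 2$, let $U:\mathbb{R}^\Lambda\to\mathbb{R}\times\mathbb{R}^{N-1}$ be an orthogonal linear map with $(U\phi)_1=N^{-1/2}\sum_{x\in\Lambda}\phi(x)$ for all $\phi\in\mathbb{R}^\Lambda$. For $\rho>0$, $|m|<\sqrt\rho$ and bounded continuous $F:\mathbb{R}^\Lambda\to\mathbb{R}$, define the auxiliary microcanonical expectation and partition function $$\langle F\rangle_{\mathrm{MC}}^{m,\rho;N}:=\frac{1}{|\mathbb{S}^{N-2}|}\int_{\mathbb{S}^{N-2}}d\Omega\,(F\circ U^{-1})\bigl(m\sqrt N,\sqrt{N(\rho-m^2)}\,\Omega\bigr),\qquad Z_{\mathrm{MC}}(m,\rho;N):=(\rho-m^2)^{\frac{N-3}{2}},$$ and, for $\mu\in\mathbb{R}$, the auxiliary canonical expectation $$\langle F\rangle_{\mathrm{C}}^{\mu,\rho;N}:=\frac{\int_{-\sqrt\rho}^{\sqrt\rho}dm'\,e^{-\mu Nm'}Z_{\mathrm{MC}}(m',\rho;N)\,\langle F\rangle_{\mathrm{MC}}^{m',\rho;N}}{\int_{-\sqrt\rho}^{\sqrt\rho}dm'\,e^{-\mu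 Nm'}Z_{\mathrm{MC}}(m',\rho;N)}.$$ For $I\subset\Lambda$ with $|I|=n$ and a bijection $\pi:I\to\{1,\dots,n\}$, let $P_I:\mathbb{R}^\Lambda\to\mathbb{R}^n$, $(P_I\phi)_j:=\phi(\pi^{-1}(j))$. **Theorem.** Let $\rho>0$ and $m\in(-\sqrt\rho,\sqrt\rho)$, and define $\mu:=-\frac{m}{\rho-m^2}$. Let $n\ge 0$ be a fixed integer and let $f:\mathbb{R}^n\to\mathbb{R}$ be bounded and $1$-Lipschitz with respect to the Euclidean norm $\|\cdot\|_2$. Then $$\langle f\circ P_I\rangle_{\mathrm{MC}}^{m,\rho;N}=\langle f\circ P_I\rangle_{\mathrm{C}}^{\mu,\rho;N}+O(N^{-1/2})\qquad(N\to\infty),$$ that is, there are $C\in\mathbb{R}$ and $N_0\in\mathbb{N}$, depending only on $\rho$, $m$, $n$ and $f$, such that $$\bigl|\langle f\circ P_I\rangle_{\mathrm{MC}}^{m,\rho;N}-\langle f\circ P_I\rangle_{\mathrm{C}}^{\mu,\rho;N}\bigr|\le C\,N^{-1/2}$$ for every finite set $\Lambda$ with $N=|\Lambda|\ge N_0$,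 every $U$ as above, every $I\subset\Lambda$ with $|I|=n$ and every bijection $\pi:I\to\{1,\dots,n\}$. -/

import Mathlib

open MeasureTheory

namespace MeanFieldSpherical

noncomputable section

/-- The space `ℝ × ℝ^(N - 1)` with its Euclidean norm, written in the coordinates `(z, ψ)`. -/
abbrev SplitSpace (N : ℕ) : Type :=
  WithLp 2 (ℝ × EuclideanSpace ℝ (Fin (N - 1)))

/-- An orthogonal map `U : ℝ^Λ → ℝ × ℝ^(N - 1)`, `N = |Λ|`, whose first coordinate is
`N^(-1/2) ∑ x, φ x`. Its remaining coordinates then vanish on constant fields, so that `U`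
diagonalizes the matrix whose entries are all equal to `1`. -/
def IsMagnetizationFrame {Λ : Type*} [Fintype Λ]
    (U : EuclideanSpace ℝ Λ ≃ₗᵢ[ℝ] SplitSpace (Fintype.card Λ)) : Prop :=
  ∀ φ : EuclideanSpace ℝ Λ,
    (U φ).fst = 1 / Real.sqrt (Fintype.card Λ : ℝ) * ∑ x, φ x

/-- Expectation `⟨F⟩_MC^{m, ρ; N}` in the auxiliary microcanonical ensemble: the normalized
surface average of `F (U⁻¹ (m √N, √(N (ρ - m²)) Ω))` over `Ω` in the unit sphere of `ℝ^(N - 1)`. -/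
def microcanonical {Λ : Type*} [Fintype Λ]
    (U : EuclideanSpace ℝ Λ ≃ₗᵢ[ℝ] SplitSpace (Fintype.card Λ)) (m ρ : ℝ)
    (F : EuclideanSpace ℝ Λ → ℝ) : ℝ :=
  let N : ℕ := Fintype.card Λ
  let σ : Measure (Metric.sphere (0 : EuclideanSpace ℝ (Fin (N - 1))) 1) :=
    (volume : Measure (EuclideanSpace ℝ (Fin (N - 1)))).toSphere
  1 / σ.real Set.univ *
    ∫ Ω, F (U.symm (WithLp.toLp 2
      (m * Real.sqrt N, Real.sqrt (N * (ρ - m ^ 2)) • (Ω : EuclideanSpace ℝ (Fin (N - 1)))))) ∂σ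

/-- The specific auxiliary microcanonical partition function `(ρ - m²)^((N - 3) / 2)`. -/
def microcanonicalZ (m ρ : ℝ) (N : ℕ) : ℝ :=
  (ρ - m ^ 2) ^ (((N : ℝ) - 3) / 2)

/-- Expectation `⟨F⟩_C^{μ, ρ; N}` in the auxiliary canonical ensemble: the mixture over the
magnetization density `m ∈ (-√ρ, √ρ)` of the auxiliary microcanonical ensembles, with weights
proportional to `exp (-μ N m) Z_MC (m, ρ; N)`. -/
def canonical {Λ : Type*} [Fintype Λ]
    (U : EuclideanSpace ℝ Λ ≃ₗᵢ[ℝ] SplitSpace (Fintype.card Λ)) (μ ρ : ℝ)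
    (F : EuclideanSpace ℝ Λ → ℝ) : ℝ :=
  let N : ℕ := Fintype.card Λ
  1 / (∫ m in (-Real.sqrt ρ)..(Real.sqrt ρ), Real.exp (-μ * N * m) * microcanonicalZ m ρ N) *
    ∫ m in (-Real.sqrt ρ)..(Real.sqrt ρ),
      Real.exp (-μ * N * m) * microcanonicalZ m ρ N * microcanonical U m ρ F

/-- The projection `P_I : ℝ^Λ → ℝ^n` onto the coordinates in `I`, for `I ⊂ Λ` enumerated by a
bijection `π : I → {0, …, n - 1}`. -/
def proj {Λ : Type*} {n : ℕ} (I : Finset Λ) (π : I ≃ Fin n)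
    (φ : EuclideanSpace ℝ Λ) : EuclideanSpace ℝ (Fin n) :=
  WithLp.toLp 2 fun j => φ (π.symm j : Λ)

end

end MeanFieldSpherical

/-! The canonical expectation averages the microcanonical ones over the magnetization `x`, so two
facts suffice: the microcanonical expectation of a local observable is Lipschitz in `x` uniformly in
`N` (`abs_microcanonical_sub_le`), and `x` has mean distance O(N^(-1/2)) from `m`
(`integral_weight_mul_abs_le`).

For the first, couple the ensembles at `m` and `x` through the same point of the sphere; the cost is
a second moment of one spherical coordinate, known from rotation invariance. For the second, `μ`
makes `m` the critical point of the exponent `-μ x + log (ρ - x ^ 2) / 2`, and one exact integration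
by parts gives a variance of order 1/N, without Laplace asymptotics. -/

namespace MeanFieldSpherical

/-! ### Rotation invariance and second moments on the unit sphere -/

section Sphere

variable {E : Type*} [NormedAddCommGroup E] [InnerProductSpace ℝ E] [FiniteDimensional ℝ E]
  [MeasurableSpace E] [BorelSpace E]

/-- The action of a linear isometry on the unit sphere. -/
def sphereMap (e : E ≃ₗᵢ[ℝ] E) (x : Metric.sphere (0 : E) 1) : Metric.sphere (0 : E) 1 :=
  ⟨e x, by simp⟩

theorem measurePreserving_sphereMap (e : E ≃ₗᵢ[ℝ] E) :
    MeasurePreserving (sphereMap e) (volume : Measure E).toSphere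
      (volume : Measure E).toSphere := by
  have hmeas : Measurable (sphereMap e) :=
    (Continuous.subtype_mk (by fun_prop) _).measurable
  refine ⟨hmeas, Measure.ext fun s hs => ?_⟩
  rw [Measure.map_apply hmeas hs, Measure.toSphere_apply' _ hs,
    Measure.toSphere_apply' _ (hmeas hs)]
  congr 1
  refine Eq.trans ?_
    (e.measurePreserving.measure_preimage_emb e.toHomeomorph.measurableEmbedding _)
  congr 1
  ext x
  simp only [Set.mem_smul, Set.mem_image, Set.mem_preimage]
  constructor
  · rintro ⟨r, hr, _, ⟨y, hy, rfl⟩, rfl⟩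
    exact ⟨r, hr, _, ⟨_, hy, rfl⟩, by simp [sphereMap]⟩
  · rintro ⟨r, hr, _, ⟨y, hy, rfl⟩, h⟩
    refine ⟨r, hr, _, ⟨sphereMap e.symm y, ?_, rfl⟩, ?_⟩
    · simpa [sphereMap] using hy
    · apply e.injective
      simpa [sphereMap] using h

theorem integrable_sphere {g : Metric.sphere (0 : E) 1 → ℝ} (hg : Continuous g) :
    Integrable g (volume : Measure E).toSphere :=
  hg.integrable_of_hasCompactSupport (HasCompactSupport.of_compactSpace g)

/-- The reflection in the hyperplane orthogonal to `v - w` takes `v` to `w` and preserves the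
surface measure. -/
theorem integral_sphere_inner_sq_eq_of_norm_eq {v w : E} (h : ‖v‖ = ‖w‖) :
    ∫ x : Metric.sphere (0 : E) 1, inner ℝ v (x : E) ^ 2 ∂(volume : Measure E).toSphere =
      ∫ x : Metric.sphere (0 : E) 1, inner ℝ w (x : E) ^ 2 ∂(volume : Measure E).toSphere := by
  set e : E ≃ₗᵢ[ℝ] E := (ℝ ∙ (v - w))ᗮ.reflection
  have he : e v = w := Submodule.reflection_sub h
  have hmp := measurePreserving_sphereMap e
  rw [← he]
  conv_rhs => rw [← hmp.map_eq]
  rw [integral_map hmp.measurable.aemeasurable]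
  · simp [sphereMap]
  · exact (Continuous.pow (by fun_prop) 2).aestronglyMeasurable

/-- The second moments of the uniform measure on the unit sphere. -/
theorem integral_sphere_inner_sq (v : E) :
    Module.finrank ℝ E *
      ∫ x : Metric.sphere (0 : E) 1, inner ℝ v (x : E) ^ 2 ∂(volume : Measure E).toSphere =
      ‖v‖ ^ 2 * (volume : Measure E).toSphere.real Set.univ := by
  set b := stdOrthonormalBasis ℝ E
  -- Every basis direction has the same second moment, and on the sphere the squared coordinates sum
  -- to 1.
  have h1 : ∀ i, ∫ x : Metric.sphere (0 : E) 1, inner ℝ v (x : E) ^ 2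
      ∂(volume : Measure E).toSphere = ‖v‖ ^ 2 * ∫ x : Metric.sphere (0 : E) 1,
        inner ℝ (b i) (x : E) ^ 2 ∂(volume : Measure E).toSphere := by
    intro i
    rw [integral_sphere_inner_sq_eq_of_norm_eq (w := ‖v‖ • b i) (by simp [norm_smul]),
      ← integral_const_mul]
    simp [inner_smul_left, mul_pow]
  have h2 : ∑ i, ∫ x : Metric.sphere (0 : E) 1, inner ℝ (b i) (x : E) ^ 2
      ∂(volume : Measure E).toSphere = (volume : Measure E).toSphere.real Set.univ := by
    have hi : ∀ i, Integrable (fun x : Metric.sphere (0 : E) 1 => inner ℝ (b i) (x : E) ^ 2)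
        (volume : Measure E).toSphere := fun i => integrable_sphere (by fun_prop)
    rw [← integral_finsetSum _ fun i _ => hi i]
    have : ∀ x : Metric.sphere (0 : E) 1, ∑ i, inner ℝ (b i) (x : E) ^ 2 = (1 : ℝ) := fun x => by
      rw [b.sum_sq_inner_right]; simp
    simp [this, measureReal_def]
  calc _ = ∑ i : Fin (Module.finrank ℝ E), ∫ x : Metric.sphere (0 : E) 1, inner ℝ v (x : E) ^ 2
        ∂(volume : Measure E).toSphere := by simp
    _ = _ := by rw [Finset.sum_congr rfl fun i _ => h1 i, ← Finset.mul_sum, h2]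

end Sphere

/-! ### Concentration of the magnetization -/

section Density

/-- The unnormalized density of the magnetization in the canonical ensemble. -/
noncomputable def weight (μ ρ : ℝ) (N : ℕ) (x : ℝ) : ℝ :=
  Real.exp (-μ * N * x) * microcanonicalZ x ρ N

theorem continuous_weight (μ ρ : ℝ) {N : ℕ} (hN : 3 ≤ N) : Continuous (weight μ ρ N) := by
  have hN' : (3 : ℝ) ≤ N := by exact_mod_cast hN
  unfold weight microcanonicalZ
  exact (by fun_prop : Continuous fun x : ℝ => Real.exp (-μ * N * x)).mul
    (Continuous.rpow_const (by fun_prop) fun x => Or.inr (by linarith))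

theorem sub_sq_pos_of_mem_Ioo {ρ x : ℝ} (hx : x ∈ Set.Ioo (-√ρ) √ρ) : 0 < ρ - x ^ 2 := by
  have := Real.sq_lt.2 ⟨hx.1, hx.2⟩
  linarith

theorem weight_pos {μ ρ x : ℝ} (N : ℕ) (hx : x ∈ Set.Ioo (-√ρ) √ρ) : 0 < weight μ ρ N x :=
  mul_pos (Real.exp_pos _) (Real.rpow_pos_of_pos (sub_sq_pos_of_mem_Ioo hx) _)

theorem sub_sq_nonneg_of_mem_Icc {ρ x : ℝ} (hρ : 0 ≤ ρ) (hx : x ∈ Set.Icc (-√ρ) √ρ) :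
    0 ≤ ρ - x ^ 2 := by
  have := Real.sq_le hρ |>.2 ⟨hx.1, hx.2⟩
  linarith

theorem weight_nonneg {μ ρ x : ℝ} (N : ℕ) (hρ : 0 ≤ ρ) (hx : x ∈ Set.Icc (-√ρ) √ρ) :
    0 ≤ weight μ ρ N x :=
  mul_nonneg (Real.exp_nonneg _) (Real.rpow_nonneg (sub_sq_nonneg_of_mem_Icc hρ hx) _)

theorem integral_weight_pos (μ : ℝ) {ρ : ℝ} {N : ℕ} (hρ : 0 < ρ) (hN : 3 ≤ N) :
    0 < ∫ x in (-√ρ)..√ρ, weight μ ρ N x := by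
  have := Real.sqrt_pos.2 hρ
  exact intervalIntegral.intervalIntegral_pos_of_pos_on
    ((continuous_weight μ ρ hN).intervalIntegrable _ _) (fun x hx => weight_pos N hx) (by linarith)

/-- Integration by parts against the density of the magnetization. -/
theorem integral_weight_mul_eq_zero {ρ m : ℝ} {N : ℕ} (hρ : 0 < ρ) (hm : m ∈ Set.Ioo (-√ρ) √ρ)
    (hN : 3 ≤ N) :
    ∫ x in (-√ρ)..√ρ, weight (-(m / (ρ - m ^ 2))) ρ N x *
      ((ρ - x * m) - N / (ρ - m ^ 2) * ((x - m) ^ 2 * (ρ + x * m))) = 0 := by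
  have hN' : (3 : ℝ) ≤ N := by exact_mod_cast hN
  have hd : 0 < ρ - m ^ 2 := sub_sq_pos_of_mem_Ioo hm
  have hs := Real.sqrt_pos.2 hρ
  set c : ℝ := -(-(m / (ρ - m ^ 2))) * N with hc
  -- The power (N - 1)/2, one above that in `weight`, kills the boundary terms. By the choice of
  -- `μ`, the logarithmic derivative of the factor after `x - m` vanishes at `m` up to a term
  -- without `N`, which produces the square `(x - m) ^ 2`.
  set G : ℝ → ℝ := fun x => (x - m) * (Real.exp (c * x) * (ρ - x ^ 2) ^ (((N : ℝ) - 1) / 2)) with hG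
  have hG0 : ∀ x, x ^ 2 = ρ → G x = 0 := fun x hx => by
    simp only [hG, hx, sub_self]
    rw [Real.zero_rpow (by linarith)]
    simp
  have key := intervalIntegral.integral_eq_sub_of_hasDerivAt_of_le (f := G)
    (f' := fun x => weight (-(m / (ρ - m ^ 2))) ρ N x *
      ((ρ - x * m) - N / (ρ - m ^ 2) * ((x - m) ^ 2 * (ρ + x * m))))
    (by linarith : -√ρ ≤ √ρ) ?_ ?_ ?_
  · rw [key, hG0, hG0, sub_zero]
    · rw [neg_sq, Real.sq_sqrt hρ.le]
    · rw [Real.sq_sqrt hρ.le]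
  · have : Continuous fun x : ℝ => (ρ - x ^ 2) ^ (((N : ℝ) - 1) / 2) :=
      Continuous.rpow_const (by fun_prop) fun x => Or.inr (by linarith)
    exact Continuous.continuousOn (by fun_prop)
  · intro x hx
    have hx0 := sub_sq_pos_of_mem_Ioo hx
    have h1 : HasDerivAt (fun x : ℝ => ρ - x ^ 2) (-(2 * x)) x := by
      simpa using (hasDerivAt_pow 2 x).const_sub ρ
    have h2 := h1.rpow_const (p := ((N : ℝ) - 1) / 2) (Or.inl hx0.ne')
    have h3 : HasDerivAt (fun x : ℝ => Real.exp (c * x)) (Real.exp (c * x) * c) x := by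
      simpa using ((hasDerivAt_id x).const_mul c).exp
    have h4 := ((hasDerivAt_id x).sub_const m).mul (h3.mul h2)
    refine h4.congr_deriv ?_
    have h5 : (ρ - x ^ 2) ^ (((N : ℝ) - 1) / 2) =
        (ρ - x ^ 2) ^ (((N : ℝ) - 3) / 2) * (ρ - x ^ 2) := by
      rw [← Real.rpow_add_one hx0.ne']
      congr 1; ring
    have h6 : ((N : ℝ) - 1) / 2 - 1 = ((N : ℝ) - 3) / 2 := by ring
    simp only [weight, microcanonicalZ, ← hc, Pi.mul_apply, id_eq, h5, h6]
    rw [hc]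
    field_simp
    ring
  · exact ((continuous_weight _ ρ hN).mul (by fun_prop)).intervalIntegrable _ _

/-- In the integration by parts identity, `ρ - x * m ≤ 2 * ρ`, while `ρ + x * m` stays above `ρ - √ρ
* |m| > 0` because `|m| < √ρ`. -/
theorem integral_weight_mul_sq_le {ρ m : ℝ} {N : ℕ} (hρ : 0 < ρ) (hm : m ∈ Set.Ioo (-√ρ) √ρ)
    (hN : 3 ≤ N) :
    N * ∫ x in (-√ρ)..√ρ, weight (-(m / (ρ - m ^ 2))) ρ N x * (x - m) ^ 2 ≤
      2 * ρ * (ρ - m ^ 2) / (ρ - √ρ * |m|) *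
        ∫ x in (-√ρ)..√ρ, weight (-(m / (ρ - m ^ 2))) ρ N x := by
  have hN' : (3 : ℝ) ≤ N := by exact_mod_cast hN
  have hd : 0 < ρ - m ^ 2 := sub_sq_pos_of_mem_Ioo hm
  have hs := Real.sqrt_pos.2 hρ
  have hss := Real.mul_self_sqrt hρ.le
  have hmabs : |m| < √ρ := abs_lt.2 hm
  have hc : 0 < ρ - √ρ * |m| := by nlinarith
  have hw := continuous_weight (-(m / (ρ - m ^ 2))) ρ hN
  set w := weight (-(m / (ρ - m ^ 2))) ρ N with hwdef
  have h0 : 0 ≤ ∫ x in (-√ρ)..√ρ, w x * (2 * ρ -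
      N / (ρ - m ^ 2) * ((x - m) ^ 2 * (ρ - √ρ * |m|))) := by
    rw [← integral_weight_mul_eq_zero hρ hm hN]
    refine intervalIntegral.integral_mono_on (by linarith)
      ((hw.mul (by fun_prop)).intervalIntegrable _ _)
      ((hw.mul (by fun_prop)).intervalIntegrable _ _) fun x hx => ?_
    have hxm : |x * m| ≤ √ρ * |m| := by
      rw [abs_mul]
      exact mul_le_mul_of_nonneg_right (abs_le.2 hx) (abs_nonneg _)
    have hxm' := abs_le.1 hxm
    refine mul_le_mul_of_nonneg_left ?_ (weight_nonneg N hρ.le hx)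
    have : (N : ℝ) / (ρ - m ^ 2) * ((x - m) ^ 2 * (ρ - √ρ * |m|)) ≤
        N / (ρ - m ^ 2) * ((x - m) ^ 2 * (ρ + x * m)) := by
      gcongr
      linarith
    linarith
  have h1 : ∫ x in (-√ρ)..√ρ, w x * (2 * ρ -
      N / (ρ - m ^ 2) * ((x - m) ^ 2 * (ρ - √ρ * |m|))) =
      2 * ρ * (∫ x in (-√ρ)..√ρ, w x) - N / (ρ - m ^ 2) * (ρ - √ρ * |m|) *
        ∫ x in (-√ρ)..√ρ, w x * (x - m) ^ 2 := by
    rw [← intervalIntegral.integral_const_mul, ← intervalIntegral.integral_const_mul,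
      ← intervalIntegral.integral_sub ((by fun_prop : Continuous _).intervalIntegrable _ _)
        ((by fun_prop : Continuous _).intervalIntegrable _ _)]
    congr 1; ext x; ring
  rw [h1] at h0
  rw [div_mul_eq_mul_div, le_div_iff₀ hc]
  have h2 := mul_nonneg h0 hd.le
  have h3 : (N : ℝ) / (ρ - m ^ 2) * (ρ - m ^ 2) = N := div_mul_cancel₀ _ hd.ne'
  linear_combination h2 - (ρ - √ρ * |m|) * (∫ x in (-√ρ)..√ρ, w x * (x - m) ^ 2) * h3

/-- The magnetization has fluctuations of order `N ^ (-1 / 2)` around `m`. -/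
theorem integral_weight_mul_abs_le {ρ m : ℝ} {N : ℕ} (hρ : 0 < ρ) (hm : m ∈ Set.Ioo (-√ρ) √ρ)
    (hN : 3 ≤ N) :
    ∫ x in (-√ρ)..√ρ, weight (-(m / (ρ - m ^ 2))) ρ N x * |x - m| ≤
      (2 * ρ * (ρ - m ^ 2) / (ρ - √ρ * |m|) + 1) / (2 * √N) *
        ∫ x in (-√ρ)..√ρ, weight (-(m / (ρ - m ^ 2))) ρ N x := by
  have hN' : (0 : ℝ) < N := by exact_mod_cast (by omega : 0 < N)
  have hsN := Real.sqrt_pos.2 hN'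
  have hs := Real.sqrt_pos.2 hρ
  have hw := continuous_weight (-(m / (ρ - m ^ 2))) ρ hN
  have h0 := integral_weight_mul_sq_le hρ hm hN
  set w := weight (-(m / (ρ - m ^ 2))) ρ N with hwdef
  have h1 : ∫ x in (-√ρ)..√ρ, w x * |x - m| ≤
      ∫ x in (-√ρ)..√ρ, (N / (2 * √N) * (w x * (x - m) ^ 2) + 1 / (2 * √N) * w x) := by
    refine intervalIntegral.integral_mono_on (by linarith)
      ((by fun_prop : Continuous _).intervalIntegrable _ _)
      ((by fun_prop : Continuous _).intervalIntegrable _ _) fun x hx => ?_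
    -- AM-GM, scaled so that both terms are of order N^(-1/2) after integration.
    have : |x - m| ≤ N / (2 * √N) * (x - m) ^ 2 + 1 / (2 * √N) := by
      rw [div_mul_eq_mul_div, ← add_div, le_div_iff₀ (by positivity), ← sq_abs (x - m)]
      nlinarith [sq_nonneg (√N * |x - m| - 1), Real.sq_sqrt hN'.le]
    calc w x * |x - m| ≤ w x * (N / (2 * √N) * (x - m) ^ 2 + 1 / (2 * √N)) :=
          mul_le_mul_of_nonneg_left this (weight_nonneg N hρ.le hx)
      _ = _ := by ring
  rw [intervalIntegral.integral_add ((by fun_prop : Continuous _).intervalIntegrable _ _)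
    ((by fun_prop : Continuous _).intervalIntegrable _ _),
    intervalIntegral.integral_const_mul, intervalIntegral.integral_const_mul] at h1
  refine h1.trans ?_
  rw [div_mul_eq_mul_div, div_mul_eq_mul_div, div_mul_eq_mul_div, ← add_div]
  gcongr
  linarith

end Density

/-! ### Lipschitz dependence of the microcanonical expectation on the magnetization -/

section Microcanonical

variable {Λ : Type*}

theorem continuous_proj {n : ℕ} (I : Finset Λ) (π : I ≃ Fin n) : Continuous (proj I π) := by
  unfold proj
  fun_prop

variable [Fintype Λ] {U : EuclideanSpace ℝ Λ ≃ₗᵢ[ℝ] SplitSpace (Fintype.card Λ)}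

open Classical in
/-- The vector representing the fluctuation part of the coordinate `x` in the frame `U`. -/
noncomputable def coordVec (U : EuclideanSpace ℝ Λ ≃ₗᵢ[ℝ] SplitSpace (Fintype.card Λ)) (x : Λ) :
    EuclideanSpace ℝ (Fin (Fintype.card Λ - 1)) :=
  (U (EuclideanSpace.single x 1)).snd

theorem norm_coordVec_le (x : Λ) : ‖coordVec U x‖ ≤ 1 := by
  classical
  have h := WithLp.prod_norm_sq_eq_of_L2 (U (EuclideanSpace.single x 1))
  rw [U.norm_map, PiLp.norm_single] at h
  unfold coordVec
  have := sq_nonneg ‖(U (EuclideanSpace.single x 1)).fst‖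
  refine le_of_sq_le_sq ?_ zero_le_one
  simp only [norm_one] at h
  convert (by linarith : ‖(U (EuclideanSpace.single x 1)).snd‖ ^ 2 ≤ 1 ^ 2) using 5

/-- Pair with the basis vector at `x` and move `U` across the inner product; the frame condition
fixes the first component. -/
theorem symm_apply_eq (hU : IsMagnetizationFrame U) (a : ℝ)
    (w : EuclideanSpace ℝ (Fin (Fintype.card Λ - 1))) (x : Λ) :
    U.symm (WithLp.toLp 2 (a, w)) x =
      a / √(Fintype.card Λ : ℝ) + inner ℝ (coordVec U x) w := by
  classical
  have h1 : U.symm (WithLp.toLp 2 (a, w)) x =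
      inner ℝ (EuclideanSpace.single x (1 : ℝ)) (U.symm (WithLp.toLp 2 (a, w))) := by
    simp [EuclideanSpace.inner_single_left]
  rw [h1, ← U.inner_map_map, U.apply_symm_apply, WithLp.prod_inner_apply]
  have h2 : (U (EuclideanSpace.single x 1)).fst = 1 / √(Fintype.card Λ : ℝ) := by
    rw [hU]; simp
  congr 1
  · change inner ℝ (U (EuclideanSpace.single x 1)).fst a = _
    rw [h2]
    simp [div_eq_mul_inv]

theorem norm_le_sum_abs {n : ℕ} (v : EuclideanSpace ℝ (Fin n)) : ‖v‖ ≤ ∑ j, |v j| := by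
  rw [EuclideanSpace.norm_eq]
  refine Real.sqrt_le_iff.2 ⟨Finset.sum_nonneg fun _ _ => abs_nonneg _, ?_⟩
  exact Finset.sum_sq_le_sq_sum_of_nonneg fun _ _ => abs_nonneg _

/-- Multiply by the conjugate sum, bounded below by `√(ρ - m ^ 2)` alone; hence the estimate
survives as `x` reaches the endpoints. -/
theorem abs_sqrt_sub_sqrt_le {ρ m x : ℝ} (hρ : 0 < ρ) (hm : m ∈ Set.Ioo (-√ρ) √ρ)
    (hx : x ∈ Set.Icc (-√ρ) √ρ) :
    |√(ρ - m ^ 2) - √(ρ - x ^ 2)| ≤ 2 * √ρ / √(ρ - m ^ 2) * |x - m| := by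
  have hd := Real.sqrt_pos.2 (sub_sq_pos_of_mem_Ioo hm)
  rw [div_mul_eq_mul_div, le_div_iff₀ hd]
  have h1 : |√(ρ - m ^ 2) - √(ρ - x ^ 2)| * (√(ρ - m ^ 2) + √(ρ - x ^ 2)) =
      |x + m| * |x - m| := by
    rw [← abs_of_nonneg (by positivity : 0 ≤ √(ρ - m ^ 2) + √(ρ - x ^ 2)), ← abs_mul, ← abs_mul]
    congr 1
    have h2 := Real.mul_self_sqrt (sub_sq_pos_of_mem_Ioo hm).le
    have h3 := Real.mul_self_sqrt (sub_sq_nonneg_of_mem_Icc hρ.le hx)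
    linear_combination h2 - h3
  have h4 : |x + m| ≤ 2 * √ρ := abs_le.2 ⟨by linarith [hx.1, hm.1], by linarith [hx.2, hm.2]⟩
  calc _ ≤ |√(ρ - m ^ 2) - √(ρ - x ^ 2)| * (√(ρ - m ^ 2) + √(ρ - x ^ 2)) := by
        gcongr; linarith [Real.sqrt_nonneg (ρ - x ^ 2)]
    _ ≤ _ := by rw [h1]; gcongr

theorem continuous_microcanonical_integrand {F : EuclideanSpace ℝ Λ → ℝ} (hF : Continuous F)
    (ρ : ℝ) : Continuous fun p : ℝ × Metric.sphere
      (0 : EuclideanSpace ℝ (Fin (Fintype.card Λ - 1))) 1 =>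
      F (U.symm (WithLp.toLp 2 (p.1 * √(Fintype.card Λ : ℝ),
        √((Fintype.card Λ : ℝ) * (ρ - p.1 ^ 2)) •
          (p.2 : EuclideanSpace ℝ (Fin (Fintype.card Λ - 1)))))) := by
  refine hF.comp (U.symm.continuous.comp ?_)
  exact (WithLp.prod_continuous_toLp 2 _ _).comp (by fun_prop)

theorem continuous_microcanonical {F : EuclideanSpace ℝ Λ → ℝ} (hF : Continuous F) (ρ : ℝ) :
    Continuous fun x => microcanonical U x ρ F := by
  unfold microcanonical
  refine continuous_const.mul ?_
  have := continuous_parametric_integral_of_continuous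
    (μ := (volume : Measure (EuclideanSpace ℝ (Fin (Fintype.card Λ - 1)))).toSphere)
    (f := fun x Ω => F (U.symm (WithLp.toLp 2 (x * √(Fintype.card Λ : ℝ),
        √((Fintype.card Λ : ℝ) * (ρ - x ^ 2)) •
          (Ω : EuclideanSpace ℝ (Fin (Fintype.card Λ - 1)))))))
    (continuous_microcanonical_integrand hF ρ) (s := Set.univ) isCompact_univ
  simpa using this

theorem toSphere_real_univ_pos {d : ℕ} (hd : 0 < d) :
    0 < (volume : Measure (EuclideanSpace ℝ (Fin d))).toSphere.real Set.univ := by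
  rw [Measure.toSphere_real_apply_univ, finrank_euclideanSpace_fin]
  have h1 : 0 < (volume : Measure (EuclideanSpace ℝ (Fin d))).real (Metric.ball 0 1) :=
    ENNReal.toReal_pos (Metric.measure_ball_pos _ _ one_pos).ne' measure_ball_lt_top.ne
  have h2 : (0 : ℝ) < d := by exact_mod_cast hd
  positivity

/-- By `2 * t ≤ 1 + t ^ 2` and the second moment, the average is at most 1/2 + N/(2(N - 1)). -/
theorem integral_sqrt_mul_abs_inner_le (hN : 3 ≤ Fintype.card Λ) (x : Λ) :
    ∫ Ω : Metric.sphere (0 : EuclideanSpace ℝ (Fin (Fintype.card Λ - 1))) 1,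
      √(Fintype.card Λ : ℝ) * |inner ℝ (coordVec U x)
        (Ω : EuclideanSpace ℝ (Fin (Fintype.card Λ - 1)))|
      ∂(volume : Measure (EuclideanSpace ℝ (Fin (Fintype.card Λ - 1)))).toSphere ≤
    3 / 2 * (volume : Measure (EuclideanSpace ℝ (Fin (Fintype.card Λ - 1)))).toSphere.real
      Set.univ := by
  set σ := (volume : Measure (EuclideanSpace ℝ (Fin (Fintype.card Λ - 1)))).toSphere
  set v := coordVec U x
  have hN' : (3 : ℝ) ≤ Fintype.card Λ := by exact_mod_cast hN
  have h1 := integral_sphere_inner_sq v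
  rw [finrank_euclideanSpace_fin, Nat.cast_sub (by omega), Nat.cast_one] at h1
  have hv : ‖v‖ ^ 2 ≤ 1 := pow_le_one₀ (norm_nonneg _) (norm_coordVec_le x)
  set S := ∫ Ω : Metric.sphere (0 : EuclideanSpace ℝ (Fin (Fintype.card Λ - 1))) 1, inner ℝ v
    (Ω : EuclideanSpace ℝ (Fin (Fintype.card Λ - 1))) ^ 2 ∂σ
  have hS : 0 ≤ S := integral_nonneg fun _ => sq_nonneg _
  have hσ : 0 ≤ σ.real Set.univ := measureReal_nonneg
  have h2 : ∫ Ω : Metric.sphere (0 : EuclideanSpace ℝ (Fin (Fintype.card Λ - 1))) 1,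
      √(Fintype.card Λ : ℝ) * |inner ℝ v (Ω : EuclideanSpace ℝ (Fin (Fintype.card Λ - 1)))| ∂σ ≤
      ∫ Ω : Metric.sphere (0 : EuclideanSpace ℝ (Fin (Fintype.card Λ - 1))) 1,
        (1 / 2 + Fintype.card Λ / 2 * inner ℝ v
          (Ω : EuclideanSpace ℝ (Fin (Fintype.card Λ - 1))) ^ 2) ∂σ := by
    refine integral_mono (integrable_sphere (by fun_prop)) (integrable_sphere (by fun_prop))
      fun Ω => ?_
    have h3 := two_mul_le_add_sq 1 (√(Fintype.card Λ : ℝ) *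
      |inner ℝ v (Ω : EuclideanSpace ℝ (Fin (Fintype.card Λ - 1)))|)
    rw [mul_pow, sq_abs, Real.sq_sqrt (by linarith)] at h3
    simp only
    linarith
  refine h2.trans ?_
  rw [integral_add (integrable_sphere (by fun_prop)) (integrable_sphere (by fun_prop)),
    integral_const_mul, integral_const, smul_eq_mul]
  change σ.real Set.univ * (1 / 2) + Fintype.card Λ / 2 * S ≤ _
  nlinarith [mul_le_mul_of_nonneg_right hv hσ]

/-- The microcanonical expectation of a local observable depends Lipschitz continuously on the
magnetization, uniformly in the size of the system. -/
theorem abs_microcanonical_sub_le (hU : IsMagnetizationFrame U) (hN : 3 ≤ Fintype.card Λ)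
    {n : ℕ} {f : EuclideanSpace ℝ (Fin n) → ℝ} (hf : LipschitzWith 1 f) (I : Finset Λ)
    (π : I ≃ Fin n) {ρ m x : ℝ} (hρ : 0 < ρ) (hm : m ∈ Set.Ioo (-√ρ) √ρ)
    (hx : x ∈ Set.Icc (-√ρ) √ρ) :
    |microcanonical U m ρ (f ∘ proj I π) - microcanonical U x ρ (f ∘ proj I π)| ≤
      n * (1 + 3 * √ρ / √(ρ - m ^ 2)) * |x - m| := by
  have hF : Continuous (f ∘ proj I π) := hf.continuous.comp (continuous_proj I π)
  have hc := continuous_microcanonical_integrand (U := U) hF ρ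
  have hi := fun y : ℝ => integrable_sphere (hc.comp (Continuous.prodMk_right y))
  simp only [Function.comp_def] at hi
  have hσ : 0 < (volume : Measure (EuclideanSpace ℝ (Fin (Fintype.card Λ - 1)))).toSphere.real
    Set.univ := toSphere_real_univ_pos (by omega)
  simp only [microcanonical, Function.comp_def]
  set σ := (volume : Measure (EuclideanSpace ℝ (Fin (Fintype.card Λ - 1)))).toSphere
  have hN0 : (0 : ℝ) < Fintype.card Λ := by exact_mod_cast (by omega : 0 < Fintype.card Λ)
  have hsN := Real.sqrt_pos.2 hN0
  rw [← mul_sub, ← integral_sub (hi m) (hi x), abs_mul, abs_of_pos (by positivity),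
    one_div_mul_eq_div, div_le_iff₀ hσ]
  set δ := |√(ρ - m ^ 2) - √(ρ - x ^ 2)|
  -- Both ensembles are evaluated at the same `Ω`, so only the shift of the mean and the change of
  -- radius contribute.
  have hpt : ∀ Ω : Metric.sphere (0 : EuclideanSpace ℝ (Fin (Fintype.card Λ - 1))) 1,
      ‖f (proj I π (U.symm (WithLp.toLp 2 (m * √(Fintype.card Λ : ℝ),
          √((Fintype.card Λ : ℝ) * (ρ - m ^ 2)) •
          (Ω : EuclideanSpace ℝ (Fin (Fintype.card Λ - 1))))))) -
        f (proj I π (U.symm (WithLp.toLp 2 (x * √(Fintype.card Λ : ℝ),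
          √((Fintype.card Λ : ℝ) * (ρ - x ^ 2)) •
          (Ω : EuclideanSpace ℝ (Fin (Fintype.card Λ - 1)))))))‖ ≤
      ∑ j, (|x - m| + δ * (√(Fintype.card Λ : ℝ) * |inner ℝ (coordVec U (π.symm j : Λ))
        (Ω : EuclideanSpace ℝ (Fin (Fintype.card Λ - 1)))|)) := by
    intro Ω
    refine (hf.norm_sub_le _ _).trans ?_
    rw [NNReal.coe_one, one_mul]
    refine (norm_le_sum_abs _).trans (Finset.sum_le_sum fun j _ => ?_)
    simp only [proj, PiLp.sub_apply]
    rw [symm_apply_eq hU, symm_apply_eq hU, inner_smul_right, inner_smul_right,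
      mul_div_cancel_right₀ _ hsN.ne', mul_div_cancel_right₀ _ hsN.ne',
      Real.sqrt_mul hN0.le, Real.sqrt_mul hN0.le]
    set t := inner ℝ (coordVec U (π.symm j : Λ)) (Ω : EuclideanSpace ℝ (Fin (Fintype.card Λ - 1)))
    calc _ = |(m - x) + (√(ρ - m ^ 2) - √(ρ - x ^ 2)) * (√(Fintype.card Λ : ℝ) * t)| := by congr 1; ring
      _ ≤ _ := abs_add_le _ _
      _ = _ := by rw [abs_sub_comm m x, abs_mul, abs_mul, abs_of_pos hsN]
  have hint : ∀ j : Fin n, Integrable (fun Ω : Metric.sphere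
      (0 : EuclideanSpace ℝ (Fin (Fintype.card Λ - 1))) 1 => |x - m| + δ * (√(Fintype.card Λ : ℝ) *
        |inner ℝ (coordVec U (π.symm j : Λ)) (Ω : EuclideanSpace ℝ (Fin (Fintype.card Λ - 1)))|)) σ :=
    fun j => integrable_sphere (by fun_prop)
  refine (norm_integral_le_of_norm_le (integrable_finsetSum _ fun j _ => hint j)
    (ae_of_all _ hpt)).trans ?_
  rw [integral_finsetSum _ fun j _ => hint j]
  have hj : ∀ j : Fin n, ∫ Ω : Metric.sphere (0 : EuclideanSpace ℝ (Fin (Fintype.card Λ - 1))) 1,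
      (|x - m| + δ * (√(Fintype.card Λ : ℝ) * |inner ℝ (coordVec U (π.symm j : Λ))
        (Ω : EuclideanSpace ℝ (Fin (Fintype.card Λ - 1)))|)) ∂σ ≤
      (1 + 3 * √ρ / √(ρ - m ^ 2)) * |x - m| * σ.real Set.univ := by
    intro j
    rw [integral_add (integrable_sphere (by fun_prop)) (integrable_sphere (by fun_prop)),
      integral_const_mul, integral_const, smul_eq_mul]
    have h1 := integral_sqrt_mul_abs_inner_le (U := U) hN (π.symm j : Λ)
    have h2 := mul_le_mul_of_nonneg_left h1 (abs_nonneg (√(ρ - m ^ 2) - √(ρ - x ^ 2)))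
    have h3 := mul_le_mul_of_nonneg_right (abs_sqrt_sub_sqrt_le hρ hm hx)
      (by positivity : 0 ≤ 3 / 2 * σ.real Set.univ)
    linear_combination h2 + h3
  refine (Finset.sum_le_sum fun j _ => hj j).trans (le_of_eq ?_)
  simp [mul_assoc]

end Microcanonical

/-! ### Comparison of the ensembles and conclusion -/

/-- Comparison of the two ensembles for an observable whose microcanonical expectation is Lipschitz
in the magnetization. -/
theorem abs_microcanonical_sub_canonical_le {Λ : Type*} [Fintype Λ]
    {U : EuclideanSpace ℝ Λ ≃ₗᵢ[ℝ] SplitSpace (Fintype.card Λ)}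
    {F : EuclideanSpace ℝ Λ → ℝ} (hF : Continuous F) (hN : 3 ≤ Fintype.card Λ) {ρ m μ K : ℝ}
    (hρ : 0 < ρ) (hK : ∀ x ∈ Set.Icc (-√ρ) √ρ,
      |microcanonical U m ρ F - microcanonical U x ρ F| ≤ K * |x - m|) :
    |microcanonical U m ρ F - canonical U μ ρ F| *
      ∫ x in (-√ρ)..√ρ, weight μ ρ (Fintype.card Λ) x ≤
      K * ∫ x in (-√ρ)..√ρ, weight μ ρ (Fintype.card Λ) x * |x - m| := by
  have hw := continuous_weight μ ρ hN
  have hZ := integral_weight_pos μ hρ hN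
  have hs := Real.sqrt_pos.2 hρ
  have hc : canonical U μ ρ F = 1 / (∫ x in (-√ρ)..√ρ, weight μ ρ (Fintype.card Λ) x) *
    ∫ x in (-√ρ)..√ρ, weight μ ρ (Fintype.card Λ) x * microcanonical U x ρ F := rfl
  have hmc := continuous_microcanonical (U := U) hF ρ
  set w := weight μ ρ (Fintype.card Λ)
  set Z := ∫ x in (-√ρ)..√ρ, w x
  have h1 : (microcanonical U m ρ F - canonical U μ ρ F) * Z =
      ∫ x in (-√ρ)..√ρ, w x * (microcanonical U m ρ F - microcanonical U x ρ F) := by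
    simp_rw [mul_sub]
    rw [intervalIntegral.integral_sub ((by fun_prop : Continuous _).intervalIntegrable _ _)
      ((by fun_prop : Continuous _).intervalIntegrable _ _),
      intervalIntegral.integral_mul_const, hc]
    change _ = Z * _ - _
    field_simp
  rw [← abs_of_pos hZ, ← abs_mul, h1, ← intervalIntegral.integral_const_mul,
    ← Real.norm_eq_abs]
  refine intervalIntegral.norm_integral_le_of_norm_le (by linarith)
    (ae_of_all _ fun x hx => ?_)
    ((by fun_prop : Continuous fun x => K * (w x * |x - m|)).intervalIntegrable _ _)
  have hx' : x ∈ Set.Icc (-√ρ) √ρ := ⟨hx.1.le, hx.2⟩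
  have hwx := weight_nonneg (μ := μ) (Fintype.card Λ) hρ.le hx'
  rw [Real.norm_eq_abs, abs_mul, abs_of_nonneg hwx]
  calc _ ≤ w x * (K * |x - m|) := mul_le_mul_of_nonneg_left (hK x hx') hwx
    _ = _ := by ring

end MeanFieldSpherical

open MeanFieldSpherical in
theorem mainTheorem10 (ρ m μ : ℝ) (hρ : 0 < ρ) (hm : m ∈ Set.Ioo (-Real.sqrt ρ) (Real.sqrt ρ))
    (hμ : μ = -(m / (ρ - m ^ 2))) (n : ℕ) (f : EuclideanSpace ℝ (Fin n) → ℝ)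
    (hf_bdd : ∃ B : ℝ, ∀ x, |f x| ≤ B) (hf_lip : LipschitzWith 1 f) :
    ∃ (C : ℝ) (N₀ : ℕ), ∀ (Λ : Type*) [Fintype Λ], N₀ ≤ Fintype.card Λ →
      ∀ (U : EuclideanSpace ℝ Λ ≃ₗᵢ[ℝ] MeanFieldSpherical.SplitSpace (Fintype.card Λ)),
        MeanFieldSpherical.IsMagnetizationFrame U →
      ∀ (I : Finset Λ) (π : I ≃ Fin n),
        |MeanFieldSpherical.microcanonical U m ρ (f ∘ MeanFieldSpherical.proj I π) -
          MeanFieldSpherical.canonical U μ ρ (f ∘ MeanFieldSpherical.proj I π)| ≤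
          C * (Fintype.card Λ : ℝ) ^ (-(1 / 2) : ℝ) := by
  subst hμ
  set K : ℝ := n * (1 + 3 * √ρ / √(ρ - m ^ 2)) with hKdef
  set A : ℝ := 2 * ρ * (ρ - m ^ 2) / (ρ - √ρ * |m|) + 1 with hA
  -- From N = 3 on, the exponent (N - 3)/2 is nonnegative, so the density is continuous up to the
  -- endpoints.
  refine ⟨K * A / 2, 3, fun Λ _ hN U hU I π => ?_⟩
  have hK : 0 ≤ K := by positivity
  have h1 := abs_microcanonical_sub_canonical_le (U := U) (μ := -(m / (ρ - m ^ 2)))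
    (hf_lip.continuous.comp (continuous_proj I π)) hN hρ
    fun x hx => abs_microcanonical_sub_le hU hN hf_lip I π hρ hm hx
  have h2 := mul_le_mul_of_nonneg_left (integral_weight_mul_abs_le hρ hm hN) hK
  have hZ := integral_weight_pos (-(m / (ρ - m ^ 2))) hρ hN
  have h3 := h1.trans h2
  rw [← mul_assoc] at h3
  refine (le_of_mul_le_mul_right h3 hZ).trans (le_of_eq ?_)
  rw [Real.rpow_neg (Nat.cast_nonneg _), ← Real.sqrt_eq_rpow, ← hA]
  ring
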